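/- Let $k\ge 1$ and $q\ge 1$ be integers, $\mathbf n=(n_1,\dots,n_q)\in\mathbb N_0^q$, $\boldsymbol\alpha=(\alpha_1,\dots,\alpha_k)$ with all $\alpha_i>0$, and $\mathbf s_1,\dots,\mathbf s_q\in\mathbb C^k$. For vectors write $\mathbf x\cdot\mathbf y=\sum_i x_iy_i$ (no complex conjugation), $|\mathbf x|=\sum_i x_i$, $\mathbf x\diamond\mathbf y=(x_iy_i)_i$ and $\mathbf x^{\diamond m}=(x_i^m)_i$ (with $0^0=1$); put $\mathbf n!=n_1!\cdots n_q!$ and $\langle a\rangle_m=\Gamma(a+m)/\Gamma(a)$ for $a>0$, $m\in\mathbb N_0$; and write $\mathbf a\le\mathbf n$ for the coordinatewise order. Let $\Delta^{k-1}=\{\mathbf x\in\mathbb R^k: x_i\ge 0,\ x_1+\dots+x_k=1\}$, and let $D_{\boldsymbol\alpha}$ be the Dirichlet distribution, i.e. the probability measure with density $$\mathbf 1_{\Delta^{k-1}}(\mathbf x)\,\frac{\Gamma(\alpha_1+\dots+\alpha_k)}{\Gamma(\alpha_1)\cdots\Gamma(\alpha_k)}\,x_1^{\alpha_1-1}\cdots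 x_k^{\alpha_k-1}$$ with respect to Lebesgue measure $dx_1\cdots dx_{k-1}$ on the hyperplane $x_1+\dots+x_k=1$ (the unit mass at $1$ if $k=1$). A $q$-colored partition of $\mathbf n$, written $A\vDash\mathbf n$, is a map $A:\mathbb N_0^q\setminus\{\mathbf 0\}\to\mathbb N_0$ with finite support such that $\sum_{\mathbf a\in\operatorname{supp}A}A(\mathbf a)\,\mathbf a=\mathbf n$. Its multinomial coefficient is $$M_{\mathbf n}(A)=\mathbf n!\prod_{\mathbf a\in\operatorname{supp}A}\frac{\binom{|\mathbf a|}{\mathbf a}^{A(\mathbf a)}}{|\mathbf a|^{A(\mathbf a)}\,A(\mathbf a)!},\qquad \binom{|\mathbf a|}{\mathbf a}=\frac{|\mathbf a|!}{a_1!\cdots a_q!}.$$ Define the polynomial $Z_{\mathbf n}$ in the variables $\mathbf t=(t_{\mathbf a})_{\mathbf a\le\mathbf n}$ by $$Z_{\mathbf n}(\mathbf t)=\frac1{\mathbf n!}\sum_{A\vDash\mathbf n}M_{\mathbf n}(A)\prod_{\mathbf a\in\operatorname{supp}A}t_{\mathbf a}^{A(\mathbf a)},$$ and let $$\Omega_{\mathbf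 n}[\mathbf S;\boldsymbol\alpha]=\Big(\big(\mathbf s_1^{\diamond a_1}\diamond\cdots\diamond\mathbf s_q^{\diamond a_q}\big)\cdot\boldsymbol\alpha\Big)_{\mathbf a\le\mathbf n}.$$ Then the function $\mathbf x\mapsto\prod_{j=1}^q(\mathbf s_j\cdot\mathbf x)^{n_j}$ is $D_{\boldsymbol\alpha}$-integrable on $\Delta^{k-1}$, and $$\int_{\Delta^{k-1}}\prod_{j=1}^q(\mathbf s_j\cdot\mathbf x)^{n_j}\,dD_{\boldsymbol\alpha}(\mathbf x)=\frac{\mathbf n!}{\langle|\boldsymbol\alpha|\rangle_{|\mathbf n|}}\;Z_{\mathbf n}\big(\Omega_{\mathbf n}[\mathbf S;\boldsymbol\alpha]\big).$$ -/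

import Mathlib

open scoped Nat
open MeasureTheory

namespace DirichletMoments

/-! ### The Dirichlet distribution

The number of components is `k = d + 1 ≥ 1`. -/

/-- The multivariate Euler Beta function `Γ(α₁) ⋯ Γ(α_k) / Γ(α₁ + ⋯ + α_k)`. -/
noncomputable def multiBeta {k : ℕ} (α : Fin k → ℝ) : ℝ :=
  (∏ i, Real.Gamma (α i)) / Real.Gamma (∑ i, α i)

/-- The Pochhammer symbol `Γ(a + m) / Γ(a)`, for `a > 0`. -/
noncomputable def pochhammerSymbol (a : ℝ) (m : ℕ) : ℝ :=
  Real.Gamma (a + m) / Real.Gamma a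

/-- The parametrization `(y₁, …, y_d) ↦ (y₁, …, y_d, 1 - y₁ - ⋯ - y_d)` of the hyperplane
`x₁ + ⋯ + x_{d+1} = 1`. -/
def hyperplaneParam {d : ℕ} (y : Fin d → ℝ) : Fin (d + 1) → ℝ :=
  Fin.snoc (α := fun _ => ℝ) y (1 - ∑ i, y i)

/-- Lebesgue measure `dx₁ ⋯ dx_d` on the hyperplane `x₁ + ⋯ + x_{d+1} = 1` of `ℝ^(d+1)`; for
`d = 0` this is the unit mass at the point `1`. -/
noncomputable def hyperplaneVolume (d : ℕ) : Measure (Fin (d + 1) → ℝ) :=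
  (volume : Measure (Fin d → ℝ)).map hyperplaneParam

/-- The Dirichlet distribution with parameter `α`: the measure with density
`1_Δ(x) x₁^(α₁ - 1) ⋯ x_k^(α_k - 1) / B(α₁, …, α_k)` with respect to Lebesgue measure on the
hyperplane `x₁ + ⋯ + x_k = 1`, where `Δ` is the standard simplex. -/
noncomputable def dirichlet {d : ℕ} (α : Fin (d + 1) → ℝ) : Measure (Fin (d + 1) → ℝ) :=
  (hyperplaneVolume d).withDensity
    ((stdSimplex ℝ (Fin (d + 1))).indicator
      fun x => ENNReal.ofReal ((∏ i, x i ^ (α i - 1)) / multiBeta α))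

/-! ### Colored partitions -/

/-- The index set `ℕ₀^q ∖ {0}`. -/
abbrev NonzeroVec (q : ℕ) : Type := {a : Fin q → ℕ // a ≠ 0}

/-- `col A = ∑ A(a) a`, the sum running over the support of `A`. -/
def col {q : ℕ} (A : NonzeroVec q →₀ ℕ) : Fin q → ℕ :=
  ∑ a ∈ A.support, A a • a.1

/-- The `q`-colored partitions of `n`: multisets `A` of nonzero vectors of `ℕ₀^q`, given by their
multiplicity functions, with `col A = n`.  (As every nonzero vector in the support contributes to
the sum `col A`, such a multiset has finite support.) -/
abbrev ColoredPartition {q : ℕ} (n : Fin q → ℕ) : Type :=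
  {A : NonzeroVec q →₀ ℕ // col A = n}

theorem smul_le_of_mem_support {q : ℕ} {n : Fin q → ℕ} (A : ColoredPartition n)
    {a : NonzeroVec q} (ha : a ∈ A.1.support) : A.1 a • a.1 ≤ n := by
  have h := Finset.single_le_sum (f := fun a => A.1 a • a.1) (fun b _ => zero_le) ha
  exact h.trans_eq A.2

theorem le_of_mem_support {q : ℕ} {n : Fin q → ℕ} (A : ColoredPartition n)
    {a : NonzeroVec q} (ha : a ∈ A.1.support) : a.1 ≤ n := by
  intro j
  have h := smul_le_of_mem_support A ha j
  have h1 : 1 ≤ A.1 a := Nat.one_le_iff_ne_zero.2 (Finsupp.mem_support_iff.1 ha)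
  simp only [Pi.smul_apply, smul_eq_mul] at h
  exact (Nat.le_mul_of_pos_left _ h1).trans h

instance finite_coloredPartition {q : ℕ} (n : Fin q → ℕ) : Finite (ColoredPartition n) := by
  classical
  have hs : {a : NonzeroVec q | a.1 ≤ n}.Finite :=
    (Set.finite_Iic n).preimage Subtype.val_injective.injOn
  suffices h : {A : NonzeroVec q →₀ ℕ | col A = n} ⊆
      (Finset.finsupp hs.toFinset fun _ => Finset.range (∑ j, n j + 1) : Finset _) from
    ((Finset.finite_toSet _).subset h).to_subtype
  intro A hA
  simp only [Finset.mem_coe, Finset.mem_finsupp_iff]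
  refine ⟨fun a ha => ?_, fun a _ => ?_⟩
  · simpa using le_of_mem_support ⟨A, hA⟩ ha
  · rw [Finset.mem_range, Nat.lt_succ_iff]
    by_cases ha : a ∈ A.support
    · obtain ⟨j, hj⟩ := Function.ne_iff.1 a.2
      have h := smul_le_of_mem_support ⟨A, hA⟩ ha j
      simp only [Pi.smul_apply, smul_eq_mul] at h
      have h1 : 1 ≤ a.1 j := Nat.one_le_iff_ne_zero.2 hj
      have h2 : n j ≤ ∑ j, n j := Finset.single_le_sum (fun _ _ => zero_le) (Finset.mem_univ j)
      exact ((Nat.le_mul_of_pos_right _ h1).trans h).trans h2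
    · simp [Finsupp.notMem_support_iff.1 ha]

noncomputable instance fintype_coloredPartition {q : ℕ} (n : Fin q → ℕ) :
    Fintype (ColoredPartition n) :=
  Fintype.ofFinite _

/-- `n! = n₁! ⋯ n_q!`. -/
def vecFactorial {q : ℕ} (n : Fin q → ℕ) : ℕ := ∏ j, (n j)!

/-- The multinomial coefficient of a colored partition `A` of `n`:
`n! ∏_{a ∈ supp A} (|a| choose a)^A(a) / (|a|^A(a) A(a)!)`, with `|a| = a₁ + ⋯ + a_q`. -/
def multinomialCoeff {q : ℕ} {n : Fin q → ℕ} (A : ColoredPartition n) : ℚ :=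
  (vecFactorial n : ℚ) * ∏ a ∈ A.1.support,
    (Nat.multinomial Finset.univ a.1 : ℚ) ^ A.1 a /
      (((∑ j, a.1 j : ℕ) : ℚ) ^ A.1 a * ((A.1 a)! : ℚ))

/-! ### The colored cycle index polynomial -/

/-- The colored cycle index polynomial `Z_n`, in the variables `t_a` for `a ≤ n` (coordinatewise):
`Z_n = (1 / n!) ∑_A M(A) ∏_{a ∈ supp A} t_a^A(a)`, where `A` runs over the colored partitions of
`n` and `M(A)` is the multinomial coefficient. -/
noncomputable def cycleIndex {q : ℕ} (n : Fin q → ℕ) : MvPolynomial (Set.Iic n) ℚ :=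
  MvPolynomial.C (1 / (vecFactorial n : ℚ)) *
    ∑ A : ColoredPartition n, MvPolynomial.C (multinomialCoeff A) *
      ∏ a : A.1.support, MvPolynomial.X ⟨a.1.1, le_of_mem_support A a.2⟩ ^ A.1 a.1

/-- `ω_a = (s₁^{a₁} ⋄ ⋯ ⋄ s_q^{a_q}) · α`; powers and products of vectors are coordinatewise. -/
noncomputable def omega {q k : ℕ} (s : Fin q → Fin k → ℂ) (α : Fin k → ℝ) (a : Fin q → ℕ) : ℂ :=
  (∏ j, s j ^ a j) ⬝ᵥ fun i => (α i : ℂ)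

/-- The family `Ω_n = (ω_a)_{a ≤ n}`. -/
noncomputable def Omega {q k : ℕ} (n : Fin q → ℕ) (s : Fin q → Fin k → ℂ) (α : Fin k → ℝ) :
    Set.Iic n → ℂ :=
  fun a => omega s α a.1

end DirichletMoments

/-!
Both sides are read as coefficients of generating functions in `X₁, …, X_q`, and the two generating
functions are shown to solve the same system of linear differential equations.

On the analytic side, put `L_i = ∑ⱼ sⱼᵢ Xⱼ` and let `G(α)` be the series whose coefficient at `X ^ n`
is `⟨|α|⟩_{|n|} / n!` times the expectation of `∏ⱼ (sⱼ · x) ^ nⱼ` (`momentSeries`).  Weighting the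
Dirichlet density by the coordinate `xᵢ` raises the parameter `αᵢ` by one
(`dirichletMean_coord_mul`), which gives `∂ⱼ G(α) = ∑ᵢ sⱼᵢ αᵢ G(α + eᵢ)` (`pderiv_momentSeries`).
This recursion already forces `(1 - L_i) G(α + eᵢ) = G(α)` (`one_sub_linForm_mul_momentSeries`): the
defects of these identities satisfy a homogeneous system, hence vanish
(`eq_zero_of_pderiv_mem_span`).  Therefore `∂ⱼ G(α) = (∑ᵢ sⱼᵢ αᵢ / (1 - L_i)) G(α)`; that is,
`G(α) = ∏ᵢ (1 - L_i) ^ (-αᵢ)`.  The constant term of `G(α)` is the total mass of the Dirichlet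
distribution, which is `1` by the classical Dirichlet integral (`lintegral_prod_powDensity`).

On the combinatorial side, the values of the cycle index polynomials are the coefficients of
`exp (∑ₐ (|a| choose a) ωₐ Xᵃ / |a|)` (`aeval_cycleIndex`).  Marking one part of a colored partition
and removing it differentiates this exponential (`pderiv_partitionSeries`), and the multinomial
expansion of `1 / (1 - L_i)` shows that its logarithmic derivative is again
`∑ᵢ sⱼᵢ αᵢ / (1 - L_i)` (`succ_mul_omegaWeight`).
-/

namespace DirichletMoments

open scoped ENNReal

/-! ### The Dirichlet integral -/

/-- The power density `t ↦ t ^ (a - 1)` on the closed half-line `[0, ∞)`, extended by `0`. -/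
noncomputable def powDensity (a : ℝ) : ℝ → ℝ≥0∞ :=
  (Set.Ici (0 : ℝ)).indicator fun t => ENNReal.ofReal (t ^ (a - 1))

@[fun_prop]
theorem measurable_powDensity (a : ℝ) : Measurable (powDensity a) :=
  Measurable.indicator (by fun_prop) measurableSet_Ici

theorem powDensity_of_nonneg (a : ℝ) {t : ℝ} (ht : 0 ≤ t) :
    powDensity a t = ENNReal.ofReal (t ^ (a - 1)) :=
  Set.indicator_of_mem (s := Set.Ici (0 : ℝ)) ht _

theorem powDensity_of_neg (a : ℝ) {t : ℝ} (ht : t < 0) : powDensity a t = 0 :=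
  Set.indicator_of_notMem (s := Set.Ici (0 : ℝ)) (by simpa using ht) _

/-- The convolution of two power densities is a Beta multiple of a power density.  The point `r = 0`
is excluded: there the left side is `0`, but the right side is not if `a + b = 1`, as `0 ^ 0 = 1`. -/
theorem lintegral_powDensity_mul {a b r : ℝ} (ha : 0 < a) (hb : 0 < b) (hr : r ≠ 0) :
    ∫⁻ y, powDensity a y * powDensity b (r - y) =
      ENNReal.ofReal (ProbabilityTheory.beta a b) * powDensity (a + b) r := by
  rcases hr.lt_or_gt with hr | hr
  · rw [powDensity_of_neg _ hr, mul_zero, lintegral_eq_zero_iff (by fun_prop)]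
    refine Filter.Eventually.of_forall fun y => ?_
    rcases lt_or_ge y 0 with hy | hy
    · simp [powDensity_of_neg _ hy]
    · simp [powDensity_of_neg b (show r - y < 0 by linarith)]
  have hB := ProbabilityTheory.beta_pos ha hb
  rw [← Real.smul_map_volume_mul_left hr.ne', lintegral_smul_measure,
    lintegral_map (by fun_prop) (by fun_prop), abs_of_pos hr, powDensity_of_nonneg _ hr.le]
  have key : ∀ᵐ u : ℝ, powDensity a (r * u) * powDensity b (r - r * u) =
      ENNReal.ofReal (ProbabilityTheory.beta a b * r ^ (a + b - 2)) *
        ProbabilityTheory.betaPDF a b u := by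
    filter_upwards [Measure.ae_ne volume (0 : ℝ), Measure.ae_ne volume (1 : ℝ)] with u h0 h1
    rcases h0.lt_or_gt with hu | hu
    · rw [powDensity_of_neg _ (mul_neg_of_pos_of_neg hr hu),
        ProbabilityTheory.betaPDF_eq_zero_of_nonpos hu.le, zero_mul, mul_zero]
    rcases h1.lt_or_gt with hu' | hu'
    · have h1u : 0 ≤ 1 - u := by linarith
      rw [powDensity_of_nonneg _ (by positivity), show r - r * u = r * (1 - u) by ring,
        powDensity_of_nonneg _ (by positivity), ProbabilityTheory.betaPDF_of_pos_lt_one hu hu',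
        ← ENNReal.ofReal_mul (by positivity), ← ENNReal.ofReal_mul (by positivity),
        Real.mul_rpow hr.le hu.le, Real.mul_rpow hr.le h1u,
        show a + b - 2 = (a - 1) + (b - 1) by ring, Real.rpow_add hr]
      congr 1
      field_simp
    · rw [powDensity_of_neg b (show r - r * u < 0 by nlinarith),
        ProbabilityTheory.betaPDF_eq_zero_of_one_le hu'.le, mul_zero, mul_zero]
  rw [lintegral_congr_ae key, lintegral_const_mul' _ _ ENNReal.ofReal_ne_top,
    ProbabilityTheory.lintegral_betaPDF_eq_one ha hb, mul_one, smul_eq_mul,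
    ← ENNReal.ofReal_mul hr.le, ← ENNReal.ofReal_mul hB.le]
  congr 1
  rw [show a + b - 1 = 1 + (a + b - 2) by ring, Real.rpow_add hr, Real.rpow_one]
  ring

/-- The Dirichlet integral over the simplex of size `r`, by induction on the dimension: integrating
out all but the first variable leaves a convolution of two power densities. -/
theorem lintegral_prod_powDensity {d : ℕ} (β : Fin d → ℝ) (hβ : ∀ i, 0 < β i) {b r : ℝ}
    (hb : 0 < b) (hr : r ≠ 0) :
    ∫⁻ y : Fin d → ℝ, (∏ i, powDensity (β i) (y i)) * powDensity b (r - ∑ i, y i) =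
      ENNReal.ofReal ((∏ i, Real.Gamma (β i)) * Real.Gamma b / Real.Gamma (∑ i, β i + b)) *
        powDensity (∑ i, β i + b) r := by
  induction d generalizing r with
  | zero =>
    have hG := (Real.Gamma_pos_of_pos hb).ne'
    simp [lintegral_unique, hG, volume_pi]
  | succ d ih =>
    have hs : 0 < ∑ i, β (Fin.succ i) + b :=
      add_pos_of_nonneg_of_pos (Finset.sum_nonneg fun i _ => (hβ _).le) hb
    rw [← (volume_preserving_piFinSuccAbove (fun _ : Fin (d + 1) => ℝ) 0).symm.lintegral_comp
      (by fun_prop), Measure.volume_eq_prod, lintegral_prod _ (by fun_prop)]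
    have key : ∀ᵐ t : ℝ, (∫⁻ y : Fin d → ℝ,
        (∏ i, powDensity (β i)
          ((MeasurableEquiv.piFinSuccAbove (fun _ : Fin (d + 1) => ℝ) 0).symm (t, y) i)) *
        powDensity b (r - ∑ i,
          (MeasurableEquiv.piFinSuccAbove (fun _ : Fin (d + 1) => ℝ) 0).symm (t, y) i)) =
        ENNReal.ofReal ((∏ i : Fin d, Real.Gamma (β i.succ)) * Real.Gamma b /
            Real.Gamma (∑ i : Fin d, β i.succ + b)) *
          (powDensity (β 0) t * powDensity (∑ i : Fin d, β i.succ + b) (r - t)) := by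
      filter_upwards [Measure.ae_ne volume r] with t ht
      have h := ih (fun i => β i.succ) (fun i => hβ _) (r := r - t) (sub_ne_zero.2 ht.symm)
      rw [mul_left_comm, ← h, ← lintegral_const_mul _ (by fun_prop)]
      congr 1 with y
      simp [MeasurableEquiv.piFinSuccAbove, Fin.insertNthEquiv, Fin.prod_univ_succ,
        Fin.sum_univ_succ, mul_assoc, sub_sub]
    rw [lintegral_congr_ae key, lintegral_const_mul _ (by fun_prop),
      lintegral_powDensity_mul (hβ 0) hs hr, ← mul_assoc, ← ENNReal.ofReal_mul,
      ProbabilityTheory.beta, Fin.prod_univ_succ, Fin.sum_univ_succ, add_assoc]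
    · congr 2
      have := (Real.Gamma_pos_of_pos hs).ne'
      field_simp
    · exact div_nonneg (mul_nonneg (Finset.prod_nonneg fun i _ =>
        (Real.Gamma_pos_of_pos (hβ _)).le) (Real.Gamma_pos_of_pos hb).le)
        (Real.Gamma_pos_of_pos hs).le

/-! ### The Dirichlet distribution -/

theorem multiBeta_pos {k : ℕ} [NeZero k] {α : Fin k → ℝ} (hα : ∀ i, 0 < α i) : 0 < multiBeta α :=
  div_pos (Finset.prod_pos fun i _ => Real.Gamma_pos_of_pos (hα i))
    (Real.Gamma_pos_of_pos (Finset.sum_pos (fun i _ => hα i) Finset.univ_nonempty))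

@[fun_prop]
theorem measurable_hyperplaneParam {d : ℕ} : Measurable (hyperplaneParam (d := d)) := by
  refine measurable_pi_lambda _ fun i => ?_
  induction i using Fin.lastCases with
  | last => simp only [hyperplaneParam, Fin.snoc_last]; fun_prop
  | cast i => simp only [hyperplaneParam, Fin.snoc_castSucc]; fun_prop

/-- The density of the Dirichlet distribution with respect to `hyperplaneVolume`. -/
noncomputable def dirichletDensity {d : ℕ} (α : Fin (d + 1) → ℝ) : (Fin (d + 1) → ℝ) → ℝ≥0∞ :=
  (stdSimplex ℝ (Fin (d + 1))).indicator
    fun x => ENNReal.ofReal ((∏ i, x i ^ (α i - 1)) / multiBeta α)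

theorem measurable_dirichletDensity {d : ℕ} (α : Fin (d + 1) → ℝ) :
    Measurable (dirichletDensity α) :=
  Measurable.indicator (by fun_prop) (isClosed_stdSimplex ℝ _).measurableSet

theorem dirichletDensity_lt_top {d : ℕ} (α : Fin (d + 1) → ℝ) (x : Fin (d + 1) → ℝ) :
    dirichletDensity α x < ∞ := by
  by_cases hx : x ∈ stdSimplex ℝ (Fin (d + 1)) <;> simp [dirichletDensity, hx]

theorem dirichletDensity_hyperplaneParam {d : ℕ} {α : Fin (d + 1) → ℝ} (hα : ∀ i, 0 < α i)
    (y : Fin d → ℝ) :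
    dirichletDensity α (hyperplaneParam y) = ENNReal.ofReal (multiBeta α)⁻¹ *
      ((∏ i : Fin d, powDensity (α i.castSucc) (y i)) *
        powDensity (α (Fin.last d)) (1 - ∑ i, y i)) := by
  have hprod : (∏ i : Fin d, powDensity (α i.castSucc) (y i)) *
      powDensity (α (Fin.last d)) (1 - ∑ i, y i) =
      ∏ i, powDensity (α i) (hyperplaneParam y i) := by
    simp [Fin.prod_univ_castSucc, hyperplaneParam]
  have hsum : ∑ i, hyperplaneParam y i = 1 := by
    simp [Fin.sum_univ_castSucc, hyperplaneParam]
  rw [hprod]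
  by_cases h : ∀ i, 0 ≤ hyperplaneParam y i
  · rw [dirichletDensity, Set.indicator_of_mem (show _ ∈ stdSimplex ℝ _ from ⟨h, hsum⟩),
      Finset.prod_congr rfl fun i _ => powDensity_of_nonneg (α i) (h i),
      ← ENNReal.ofReal_prod_of_nonneg fun i _ => Real.rpow_nonneg (h i) _,
      ← ENNReal.ofReal_mul (inv_nonneg.2 (multiBeta_pos hα).le), div_eq_inv_mul]
  · rw [dirichletDensity, Set.indicator_of_notMem fun hx => h hx.1]
    push Not at h
    obtain ⟨i, hi⟩ := h
    rw [Finset.prod_eq_zero (Finset.mem_univ i) (powDensity_of_neg _ hi), mul_zero]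

theorem isProbabilityMeasure_dirichlet {d : ℕ} {α : Fin (d + 1) → ℝ} (hα : ∀ i, 0 < α i) :
    IsProbabilityMeasure (dirichlet α) := by
  have hB := multiBeta_pos hα
  constructor
  change (hyperplaneVolume d).withDensity (dirichletDensity α) Set.univ = 1
  rw [withDensity_apply _ MeasurableSet.univ, Measure.restrict_univ, hyperplaneVolume,
    lintegral_map (measurable_dirichletDensity α) (by fun_prop)]
  simp_rw [dirichletDensity_hyperplaneParam hα]
  rw [lintegral_const_mul _ (by fun_prop),
    lintegral_prod_powDensity _ (fun i => hα _) (hα _) one_ne_zero,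
    powDensity_of_nonneg _ zero_le_one, Real.one_rpow, ENNReal.ofReal_one, mul_one,
    ← ENNReal.ofReal_mul (inv_nonneg.2 hB.le), ← Fin.prod_univ_castSucc (fun i => Real.Gamma (α i)),
    ← Fin.sum_univ_castSucc α, ← multiBeta, inv_mul_cancel₀ hB.ne', ENNReal.ofReal_one]

/-- The expectation of a complex function under the Dirichlet distribution. -/
noncomputable def dirichletMean {d : ℕ} (α : Fin (d + 1) → ℝ) (f : (Fin (d + 1) → ℝ) → ℂ) : ℂ :=
  ∫ x in stdSimplex ℝ (Fin (d + 1)), f x ∂(dirichlet α)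

theorem integrableOn_dirichlet {d : ℕ} {α : Fin (d + 1) → ℝ} (hα : ∀ i, 0 < α i)
    {f : (Fin (d + 1) → ℝ) → ℂ} (hf : Continuous f) :
    IntegrableOn f (stdSimplex ℝ (Fin (d + 1))) (dirichlet α) :=
  have := isProbabilityMeasure_dirichlet hα
  hf.continuousOn.integrableOn_compact (isCompact_stdSimplex ℝ _)

theorem dirichlet_restrict_stdSimplex {d : ℕ} (α : Fin (d + 1) → ℝ) :
    (dirichlet α).restrict (stdSimplex ℝ (Fin (d + 1))) = dirichlet α := by
  have hm : MeasurableSet (stdSimplex ℝ (Fin (d + 1))) := (isClosed_stdSimplex ℝ _).measurableSet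
  rw [dirichlet, restrict_withDensity hm, withDensity_indicator hm,
    withDensity_indicator hm, Measure.restrict_restrict hm, Set.inter_self]

theorem dirichletMean_eq {d : ℕ} (α : Fin (d + 1) → ℝ) (f : (Fin (d + 1) → ℝ) → ℂ) :
    dirichletMean α f =
      ∫ x, (dirichletDensity α x).toReal • f x ∂(hyperplaneVolume d) := by
  rw [dirichletMean, dirichlet_restrict_stdSimplex]
  exact integral_withDensity_eq_integral_toReal_smul (measurable_dirichletDensity α)
    (Filter.Eventually.of_forall (dirichletDensity_lt_top α)) f

theorem dirichletMean_one {d : ℕ} {α : Fin (d + 1) → ℝ} (hα : ∀ i, 0 < α i) :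
    dirichletMean α (fun _ => 1) = 1 := by
  have := isProbabilityMeasure_dirichlet hα
  simp [dirichletMean, dirichlet_restrict_stdSimplex]

theorem multiBeta_add_single {k : ℕ} [NeZero k] {α : Fin k → ℝ} (hα : ∀ i, 0 < α i) (i : Fin k) :
    multiBeta (α + Pi.single i 1) = α i / (∑ l, α l) * multiBeta α := by
  have hs : 0 < ∑ l, α l := Finset.sum_pos (fun i _ => hα i) Finset.univ_nonempty
  have h1 : ∏ l, Real.Gamma ((α + Pi.single i 1 : Fin k → ℝ) l) = α i * ∏ l, Real.Gamma (α l) := by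
    rw [← Finset.mul_prod_erase _ _ (Finset.mem_univ i),
      ← Finset.mul_prod_erase _ (fun l => Real.Gamma (α l)) (Finset.mem_univ i), ← mul_assoc]
    congr 1
    · simp [Real.Gamma_add_one (hα i).ne']
    · refine Finset.prod_congr rfl fun l hl => ?_
      simp [Finset.ne_of_mem_erase hl]
  have h2 : ∑ l, (α + Pi.single i 1 : Fin k → ℝ) l = ∑ l, α l + 1 := by
    simp [Finset.sum_add_distrib]
  rw [multiBeta, multiBeta, h1, h2, Real.Gamma_add_one hs.ne']
  have := (Real.Gamma_pos_of_pos hs).ne'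
  field_simp

/-- Size-biasing: weighting the Dirichlet distribution by a coordinate raises the corresponding
parameter by one. -/
theorem dirichletMean_coord_mul {d : ℕ} {α : Fin (d + 1) → ℝ} (hα : ∀ i, 0 < α i)
    (i : Fin (d + 1)) (f : (Fin (d + 1) → ℝ) → ℂ) :
    dirichletMean α (fun x => x i * f x) =
      (α i / ∑ l, α l : ℝ) * dirichletMean (α + Pi.single i 1) f := by
  have hs : 0 < ∑ l, α l := Finset.sum_pos (fun i _ => hα i) Finset.univ_nonempty
  rw [dirichletMean_eq, dirichletMean_eq, ← integral_const_mul]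
  congr 1 with x
  by_cases hx : x ∈ stdSimplex ℝ (Fin (d + 1))
  · have hB := multiBeta_pos hα
    have hB' := multiBeta_add_single hα i
    have hp : ∏ l, x l ^ ((α + Pi.single i 1 : Fin (d + 1) → ℝ) l - 1) =
        x i * ∏ l, x l ^ (α l - 1) := by
      rw [← Finset.mul_prod_erase _ _ (Finset.mem_univ i),
        ← Finset.mul_prod_erase _ (fun l => x l ^ (α l - 1)) (Finset.mem_univ i), ← mul_assoc]
      congr 1
      · have h : (α + Pi.single i 1 : Fin (d + 1) → ℝ) i - 1 = 1 + (α i - 1) := by simp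
        -- `x i` may vanish; the sum of the exponents is `α i ≠ 0`.
        rw [h, Real.rpow_add' (hx.1 i) (by simpa using (hα i).ne'), Real.rpow_one]
      · refine Finset.prod_congr rfl fun l hl => ?_
        simp [Finset.ne_of_mem_erase hl]
    have hn : 0 ≤ ∏ l, x l ^ (α l - 1) := Finset.prod_nonneg fun l _ => Real.rpow_nonneg (hx.1 l) _
    have hαi := hα i
    have hxi := hx.1 i
    rw [dirichletDensity, dirichletDensity, Set.indicator_of_mem hx, Set.indicator_of_mem hx, hp,
      hB', ENNReal.toReal_ofReal (by positivity), ENNReal.toReal_ofReal (by positivity),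
      Complex.real_smul, Complex.real_smul, ← mul_assoc, ← mul_assoc, ← Complex.ofReal_mul,
      ← Complex.ofReal_mul]
    congr 2
    field_simp
  · simp [dirichletDensity, hx]

/-- Expanding a linear form and size-biasing each coordinate. -/
theorem dirichletMean_dotProduct_mul {d : ℕ} {α : Fin (d + 1) → ℝ} (hα : ∀ i, 0 < α i)
    (v : Fin (d + 1) → ℂ) {f : (Fin (d + 1) → ℝ) → ℂ} (hf : Continuous f) :
    dirichletMean α (fun x => (v ⬝ᵥ fun i => (x i : ℂ)) * f x) =
      ∑ i, v i * (α i / ∑ l, α l : ℝ) * dirichletMean (α + Pi.single i 1) f := by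
  simp_rw [mul_assoc, ← dirichletMean_coord_mul hα, dotProduct, Finset.sum_mul]
  unfold dirichletMean
  rw [integral_finsetSum]
  · simp_rw [mul_assoc, integral_const_mul]
  · exact fun i _ => integrableOn_dirichlet hα (by fun_prop)

theorem pochhammerSymbol_zero {a : ℝ} (ha : 0 < a) : pochhammerSymbol a 0 = 1 := by
  simp [pochhammerSymbol, (Real.Gamma_pos_of_pos ha).ne']

theorem pochhammerSymbol_pos {a : ℝ} (ha : 0 < a) (m : ℕ) : 0 < pochhammerSymbol a m :=
  div_pos (Real.Gamma_pos_of_pos (by positivity)) (Real.Gamma_pos_of_pos ha)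

theorem pochhammerSymbol_succ {a : ℝ} (ha : 0 < a) (m : ℕ) :
    pochhammerSymbol a (m + 1) = a * pochhammerSymbol (a + 1) m := by
  have := (Real.Gamma_pos_of_pos ha).ne'
  rw [pochhammerSymbol, pochhammerSymbol, Real.Gamma_add_one ha.ne',
    show a + (m + 1 : ℕ) = a + 1 + m by push_cast; ring]
  field_simp

/-! ### Linear systems of formal partial differential equations -/

/-- A family of power series without constant terms whose partial derivatives lie in the ideal
generated by the family vanishes, as each differentiation lowers the order by at most one. -/
theorem eq_zero_of_pderiv_mem_span {σ ι R : Type*} [CommRing R] [IsAddTorsionFree R]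
    (D : ι → MvPowerSeries σ R) (h0 : ∀ x, MvPowerSeries.constantCoeff (D x) = 0)
    (hD : ∀ x j, MvPowerSeries.pderiv R j (D x) ∈ Ideal.span (Set.range D)) (x : ι) :
    D x = 0 := by
  have key : ∀ N : ℕ, ∀ x, (N : ℕ∞) ≤ (D x).order := by
    intro N
    induction N with
    | zero => simp
    | succ N ih =>
      have hspan : ∀ F ∈ Ideal.span (Set.range D), (N : ℕ∞) ≤ F.order := by
        intro F hF
        induction hF using Submodule.span_induction with
        | mem F hF => obtain ⟨y, rfl⟩ := hF; exact ih y
        | zero => simp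
        | add F G _ _ hF hG => exact (le_min hF hG).trans MvPowerSeries.min_order_le_add
        | smul a F _ hF =>
          exact (hF.trans le_add_self).trans MvPowerSeries.le_order_mul
      intro x
      refine MvPowerSeries.nat_le_order fun n hn => ?_
      by_cases h : n = 0
      · rw [h, MvPowerSeries.coeff_zero_eq_constantCoeff, h0]
      obtain ⟨j, hj⟩ := Finsupp.ne_iff.1 h
      obtain ⟨m, rfl⟩ : ∃ m, n = m + Finsupp.single j 1 := by
        refine ⟨n - Finsupp.single j 1, (tsub_add_cancel_of_le ?_).symm⟩
        simpa [Nat.one_le_iff_ne_zero] using hj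
      have hm : Finsupp.degree m < N := by
        rw [map_add, Finsupp.degree_single] at hn
        exact Nat.lt_of_succ_lt_succ hn
      have h1 := MvPowerSeries.coeff_of_lt_order
        (lt_of_lt_of_le (Nat.cast_lt.2 hm) (hspan _ (hD x j)))
      rw [MvPowerSeries.coeff_pderiv, ← Nat.cast_succ, mul_comm, ← nsmul_eq_mul] at h1
      exact (smul_eq_zero.1 h1).resolve_left (Nat.succ_ne_zero _)
  rw [← MvPowerSeries.order_eq_top_iff]
  exact ENat.eq_top_iff_forall_ge.2 fun N => key N x

/-! ### The geometric series of a linear form -/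

theorem succ_mul_multinomial_add_single {q : ℕ} (b : Fin q → ℕ) (j : Fin q) :
    (b j + 1) * Nat.multinomial Finset.univ (b + Pi.single j 1) =
      (∑ l, b l + 1) * Nat.multinomial Finset.univ b := by
  have hb := Nat.multinomial_spec Finset.univ b
  have hb' := Nat.multinomial_spec Finset.univ (b + Pi.single j 1 : Fin q → ℕ)
  have hs : ∑ l, (b + Pi.single j 1 : Fin q → ℕ) l = ∑ l, b l + 1 := by
    simp [Finset.sum_add_distrib]
  have hp : ∏ l, ((b + Pi.single j 1 : Fin q → ℕ) l)! = (b j + 1) * ∏ l, (b l)! := by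
    rw [← Finset.mul_prod_erase _ _ (Finset.mem_univ j),
      ← Finset.mul_prod_erase _ (fun l => (b l)!) (Finset.mem_univ j), ← mul_assoc]
    congr 1
    · simp [Nat.factorial_succ]
    · refine Finset.prod_congr rfl fun l hl => ?_
      simp [Finset.ne_of_mem_erase hl]
  rw [hs, hp, Nat.factorial_succ, ← hb] at hb'
  have hpos : 0 < ∏ l, (b l)! := Finset.prod_pos fun l _ => Nat.factorial_pos _
  refine Nat.eq_of_mul_eq_mul_left hpos ?_
  linarith

/-- The linear form `∑ⱼ vⱼ Xⱼ`, as a power series. -/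
noncomputable def linForm {q : ℕ} (v : Fin q → ℂ) : MvPowerSeries (Fin q) ℂ :=
  ∑ j, MvPowerSeries.C (v j) * MvPowerSeries.X j

@[simp]
theorem constantCoeff_linForm {q : ℕ} (v : Fin q → ℂ) :
    MvPowerSeries.constantCoeff (linForm v) = 0 := by
  simp [linForm]

@[simp]
theorem pderiv_linForm {q : ℕ} (v : Fin q → ℂ) (j : Fin q) :
    MvPowerSeries.pderiv ℂ j (linForm v) = MvPowerSeries.C (v j) := by
  simp [linForm, MvPowerSeries.pderiv_X, Pi.single_apply]

/-- The multinomial expansion of the geometric series `∑ₘ (∑ⱼ vⱼ Xⱼ) ^ m`. -/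
noncomputable def geomSeries {q : ℕ} (v : Fin q → ℂ) : MvPowerSeries (Fin q) ℂ :=
  fun b => (Nat.multinomial Finset.univ b : ℂ) * ∏ j, v j ^ b j

theorem coeff_geomSeries {q : ℕ} (v : Fin q → ℂ) (b : Fin q →₀ ℕ) :
    MvPowerSeries.coeff b (geomSeries v) =
      (Nat.multinomial Finset.univ b : ℂ) * ∏ j, v j ^ b j :=
  rfl

theorem prod_pow_add_single {q : ℕ} {M : Type*} [CommMonoid M] (v : Fin q → M) (b : Fin q →₀ ℕ)
    (j : Fin q) : ∏ l, v l ^ (b + Finsupp.single j 1 : Fin q →₀ ℕ) l = v j * ∏ l, v l ^ b l := by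
  simp_rw [Finsupp.add_apply, pow_add, Finset.prod_mul_distrib, Finsupp.single_apply, pow_ite,
    pow_one, pow_zero]
  simp [mul_comm]

/-- Summed over `j`, this is the functional equation `(∑ⱼ vⱼ Xⱼ) F = F - 1` of the geometric series
`F`, up to the factor `|n|`. -/
theorem coeff_X_mul_geomSeries {q : ℕ} (v : Fin q → ℂ) (n : Fin q →₀ ℕ) (j : Fin q) :
    (∑ l, n l : ℂ) * (v j * MvPowerSeries.coeff n (MvPowerSeries.X j * geomSeries v)) =
      n j * MvPowerSeries.coeff n (geomSeries v) := by
  by_cases h : n j = 0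
  · rw [MvPowerSeries.X, MvPowerSeries.coeff_monomial_mul, if_neg (by simp [h]), h]
    simp
  obtain ⟨b, rfl⟩ : ∃ b, n = b + Finsupp.single j 1 :=
    ⟨n - Finsupp.single j 1, (tsub_add_cancel_of_le
      (by simpa [Nat.one_le_iff_ne_zero] using h)).symm⟩
  have hm := congrArg (Nat.cast : ℕ → ℂ) (succ_mul_multinomial_add_single b j)
  rw [add_comm b, MvPowerSeries.X, MvPowerSeries.coeff_add_monomial_mul, add_comm _ b,
    coeff_geomSeries, coeff_geomSeries, prod_pow_add_single, Finsupp.coe_add,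
    Finsupp.single_eq_pi_single]
  push_cast at hm ⊢
  simp only [Pi.add_apply, Pi.single_eq_same, Finset.sum_add_distrib, Nat.cast_add]
  have h1 : ∑ l, (((Pi.single j 1 : Fin q → ℕ) l : ℕ) : ℂ) = 1 := by
    simp [Pi.single_apply]
  rw [h1]
  push_cast
  linear_combination (-(v j * ∏ l, v l ^ b l)) * hm

theorem one_sub_linForm_mul_geomSeries {q : ℕ} (v : Fin q → ℂ) :
    (1 - linForm v) * geomSeries v = 1 := by
  ext n
  by_cases h : n = 0
  · subst h
    have : MvPowerSeries.constantCoeff (geomSeries v) = 1 := by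
      rw [← MvPowerSeries.coeff_zero_eq_constantCoeff_apply, coeff_geomSeries]
      simp [Nat.multinomial]
    simp [this]
  have hn : (∑ l, n l : ℂ) ≠ 0 := by
    rw [← Nat.cast_sum, Nat.cast_ne_zero]
    contrapose! h
    ext l
    simpa using Finset.sum_eq_zero_iff.1 h l (Finset.mem_univ l)
  have hlin : MvPowerSeries.coeff n (linForm v * geomSeries v) =
      ∑ j, v j * MvPowerSeries.coeff n (MvPowerSeries.X j * geomSeries v) := by
    simp_rw [linForm, Finset.sum_mul, map_sum, mul_assoc, MvPowerSeries.coeff_C_mul]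
  refine mul_left_cancel₀ hn ?_
  rw [MvPowerSeries.coeff_one, if_neg h, mul_zero, sub_mul, one_mul, map_sub, hlin, mul_sub,
    Finset.mul_sum]
  simp_rw [coeff_X_mul_geomSeries]
  rw [← Finset.sum_mul, sub_self]

/-! ### The generating function of the Dirichlet moments -/

/-- The generating function of the moments, normalized so that, for positive `α`, it equals
`∏ᵢ (1 - ∑ⱼ sⱼᵢ Xⱼ) ^ (-αᵢ)`. -/
noncomputable def momentSeries {q d : ℕ} (s : Fin q → Fin (d + 1) → ℂ) (α : Fin (d + 1) → ℝ) :
    MvPowerSeries (Fin q) ℂ :=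
  fun m => (pochhammerSymbol (∑ i, α i) (∑ j, m j) : ℂ) / (vecFactorial m : ℂ) *
    dirichletMean α fun x => ∏ j, (s j ⬝ᵥ fun i => (x i : ℂ)) ^ m j

theorem coeff_momentSeries {q d : ℕ} (s : Fin q → Fin (d + 1) → ℂ) (α : Fin (d + 1) → ℝ)
    (m : Fin q →₀ ℕ) : MvPowerSeries.coeff m (momentSeries s α) =
      (pochhammerSymbol (∑ i, α i) (∑ j, m j) : ℂ) / (vecFactorial m : ℂ) *
        dirichletMean α fun x => ∏ j, (s j ⬝ᵥ fun i => (x i : ℂ)) ^ m j :=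
  rfl

theorem vecFactorial_pos {q : ℕ} (n : Fin q → ℕ) : 0 < vecFactorial n :=
  Finset.prod_pos fun _ _ => Nat.factorial_pos _

theorem vecFactorial_add_single {q : ℕ} (m : Fin q →₀ ℕ) (j : Fin q) :
    vecFactorial (m + Finsupp.single j 1 : Fin q →₀ ℕ) = (m j + 1) * vecFactorial m := by
  rw [vecFactorial, vecFactorial, ← Finset.mul_prod_erase _ _ (Finset.mem_univ j),
    ← Finset.mul_prod_erase _ (fun l => (m l)!) (Finset.mem_univ j), ← mul_assoc]
  congr 1
  · simp [Nat.factorial_succ]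
  · refine Finset.prod_congr rfl fun l hl => ?_
    simp [(Finset.ne_of_mem_erase hl).symm]

theorem constantCoeff_momentSeries {q d : ℕ} (s : Fin q → Fin (d + 1) → ℂ)
    {α : Fin (d + 1) → ℝ} (hα : ∀ i, 0 < α i) :
    MvPowerSeries.constantCoeff (momentSeries s α) = 1 := by
  have hs : 0 < ∑ l, α l := Finset.sum_pos (fun i _ => hα i) Finset.univ_nonempty
  rw [← MvPowerSeries.coeff_zero_eq_constantCoeff_apply, coeff_momentSeries]
  simp [pochhammerSymbol_zero hs, vecFactorial, dirichletMean_one hα]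

theorem add_single_pos {k : ℕ} {α : Fin k → ℝ} (hα : ∀ i, 0 < α i) (i l : Fin k) :
    0 < (α + Pi.single i 1 : Fin k → ℝ) l :=
  add_pos_of_pos_of_nonneg (hα l) (by rw [Pi.single_apply]; positivity)

/-- Differentiation splits off one linear form `sⱼ · x`, whose coordinates are absorbed into the
parameters by size-biasing. -/
theorem pderiv_momentSeries {q d : ℕ} (s : Fin q → Fin (d + 1) → ℂ) {α : Fin (d + 1) → ℝ}
    (hα : ∀ i, 0 < α i) (j : Fin q) :
    MvPowerSeries.pderiv ℂ j (momentSeries s α) =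
      ∑ i, MvPowerSeries.C (s j i * α i) * momentSeries s (α + Pi.single i 1) := by
  have hs : 0 < ∑ l, α l := Finset.sum_pos (fun i _ => hα i) Finset.univ_nonempty
  have hs' : (((∑ l, α l : ℝ)) : ℂ) ≠ 0 := Complex.ofReal_ne_zero.2 hs.ne'
  ext m
  have hf : (vecFactorial m : ℂ) ≠ 0 := Nat.cast_ne_zero.2 (vecFactorial_pos _).ne'
  have hm : ((m j : ℂ) + 1) ≠ 0 := Nat.cast_add_one_ne_zero _
  have hdeg : ∑ l, (m + Finsupp.single j 1 : Fin q →₀ ℕ) l = ∑ l, m l + 1 := by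
    simp [Finset.sum_add_distrib, Finsupp.single_apply]
  have hα' : ∀ i : Fin (d + 1), ∑ l, (α + Pi.single i 1 : Fin (d + 1) → ℝ) l = ∑ l, α l + 1 := by
    intro i; simp [Finset.sum_add_distrib]
  simp_rw [MvPowerSeries.coeff_pderiv, map_sum, MvPowerSeries.coeff_C_mul, coeff_momentSeries, hα',
    hdeg, vecFactorial_add_single, pochhammerSymbol_succ hs, prod_pow_add_single]
  rw [dirichletMean_dotProduct_mul hα _ (by unfold dotProduct; fun_prop), Finset.mul_sum,
    Finset.sum_mul]
  refine Finset.sum_congr rfl fun i _ => ?_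
  push_cast at hs' ⊢
  field_simp

/-- Raising the `i`-th parameter multiplies the generating function by the geometric series of the
`i`-th linear form.  The defects of this identity, over all `α` and `i`, form a homogeneous linear
differential system. -/
theorem one_sub_linForm_mul_momentSeries {q d : ℕ} (s : Fin q → Fin (d + 1) → ℂ)
    {α : Fin (d + 1) → ℝ} (hα : ∀ i, 0 < α i) (i : Fin (d + 1)) :
    (1 - linForm fun j => s j i) * momentSeries s (α + Pi.single i 1) = momentSeries s α := by
  let D : {α : Fin (d + 1) → ℝ // ∀ i, 0 < α i} → MvPowerSeries (Fin q) ℂ := fun β =>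
    (1 - linForm fun j => s j i) * momentSeries s (β.1 + Pi.single i 1) - momentSeries s β.1
  refine sub_eq_zero.1 (eq_zero_of_pderiv_mem_span D (fun β => ?_) (fun β j => ?_) ⟨α, hα⟩)
  · simp [D, constantCoeff_momentSeries s β.2,
      constantCoeff_momentSeries s (add_single_pos β.2 i)]
  · have key : MvPowerSeries.pderiv ℂ j (D β) =
        ∑ k, MvPowerSeries.C (s j k * ((β.1 + Pi.single i 1 : Fin (d + 1) → ℝ) k : ℝ)) *
          D ⟨β.1 + Pi.single k 1, add_single_pos β.2 k⟩ := by
      have hsplit : ∑ k, MvPowerSeries.C (s j k * ((β.1 + Pi.single i 1 : Fin (d + 1) → ℝ) k : ℝ)) *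
          momentSeries s (β.1 + Pi.single k 1) =
          ∑ k, MvPowerSeries.C (s j k * (β.1 k : ℝ)) * momentSeries s (β.1 + Pi.single k 1) +
            MvPowerSeries.C (s j i) * momentSeries s (β.1 + Pi.single i 1) := by
        simp only [Pi.add_apply, Complex.ofReal_add, mul_add, map_add, add_mul,
          Finset.sum_add_distrib]
        congr 1
        rw [Finset.sum_eq_single i (fun k _ hk => by simp [hk]) (by simp)]
        simp
      simp only [D, map_sub, Derivation.leibniz, Derivation.map_one_eq_zero, pderiv_linForm,
        pderiv_momentSeries s β.2, pderiv_momentSeries s (add_single_pos β.2 i), mul_sub,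
        Finset.sum_sub_distrib, hsplit, smul_eq_mul, Finset.mul_sum]
      simp only [add_right_comm β.1 (Pi.single i 1), mul_left_comm (MvPowerSeries.C _)]
      ring
    rw [key]
    exact Ideal.sum_mem _ fun k _ => Ideal.mul_mem_left _ _ (Ideal.subset_span ⟨_, rfl⟩)

/-- The logarithmic derivative of `∏ᵢ (1 - ∑ⱼ sⱼᵢ Xⱼ) ^ (-αᵢ)`. -/
theorem pderiv_momentSeries_eq_mul {q d : ℕ} (s : Fin q → Fin (d + 1) → ℂ)
    {α : Fin (d + 1) → ℝ} (hα : ∀ i, 0 < α i) (j : Fin q) :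
    MvPowerSeries.pderiv ℂ j (momentSeries s α) =
      (∑ i, MvPowerSeries.C (s j i * α i) * geomSeries fun j => s j i) * momentSeries s α := by
  rw [pderiv_momentSeries s hα, Finset.sum_mul]
  refine Finset.sum_congr rfl fun i _ => ?_
  have h := one_sub_linForm_mul_geomSeries fun j => s j i
  have h' := one_sub_linForm_mul_momentSeries s hα i
  linear_combination (-MvPowerSeries.C (s j i * α i) * momentSeries s (α + Pi.single i 1)) * h +
    MvPowerSeries.C (s j i * α i) * geomSeries (fun j => s j i) * h'

/-! ### The generating function of the colored partitions -/

theorem col_eq_sum {q : ℕ} (A : NonzeroVec q →₀ ℕ) : col A = A.sum fun a k => k • a.1 := rfl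

theorem col_add {q : ℕ} (A B : NonzeroVec q →₀ ℕ) : col (A + B) = col A + col B := by
  simp_rw [col_eq_sum]
  exact Finsupp.sum_add_index' (fun _ => zero_smul _ _) fun _ _ _ => add_smul _ _ _

theorem col_single {q : ℕ} (a : NonzeroVec q) : col (Finsupp.single a 1) = a.1 := by
  simp [col_eq_sum]

/-- The colored partitions of `n`, as a finite set of multiplicity functions. -/
noncomputable def partitionFinset {q : ℕ} (n : Fin q → ℕ) : Finset (NonzeroVec q →₀ ℕ) :=
  Set.Finite.toFinset (s := {A | col A = n}) (finite_coloredPartition n)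

@[simp]
theorem mem_partitionFinset {q : ℕ} {n : Fin q → ℕ} {A : NonzeroVec q →₀ ℕ} :
    A ∈ partitionFinset n ↔ col A = n :=
  Set.Finite.mem_toFinset _

theorem sum_coloredPartition {q : ℕ} {M : Type*} [AddCommMonoid M] (n : Fin q → ℕ)
    (f : (NonzeroVec q →₀ ℕ) → M) :
    ∑ A : ColoredPartition n, f A.1 = ∑ A ∈ partitionFinset n, f A :=
  (Finset.sum_subtype (partitionFinset n) (fun _ => mem_partitionFinset) f).symm

/-- The weight `∏ₐ wₐ ^ A(a) / A(a)!` of a multiset `A`. -/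
noncomputable def partitionWeight {q : ℕ} (w : (Fin q → ℕ) → ℂ) (A : NonzeroVec q →₀ ℕ) : ℂ :=
  A.prod fun a k => w a.1 ^ k / (k ! : ℂ)

theorem partitionWeight_add_single {q : ℕ} (w : (Fin q → ℕ) → ℂ) (B : NonzeroVec q →₀ ℕ)
    (a : NonzeroVec q) :
    ((B a + 1 : ℕ) : ℂ) * partitionWeight w (B + Finsupp.single a 1) =
      w a.1 * partitionWeight w B := by
  classical
  have h (A : NonzeroVec q →₀ ℕ) (hA : A.support ⊆ insert a B.support) : partitionWeight w A =
      w a.1 ^ A a / ((A a)! : ℂ) *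
        ∏ c ∈ (insert a B.support).erase a, w c.1 ^ A c / ((A c)! : ℂ) := by
    rw [partitionWeight, Finsupp.prod_of_support_subset _ hA _ (by simp),
      ← Finset.mul_prod_erase _ _ (Finset.mem_insert_self a _)]
  rw [h B (Finset.subset_insert _ _), h (B + Finsupp.single a 1) ?_]
  · rw [Finset.prod_congr rfl fun c hc => by
      rw [Finsupp.add_apply, Finsupp.single_eq_of_ne (Finset.ne_of_mem_erase hc), add_zero]]
    have h1 : ((B a : ℂ) + 1) ≠ 0 := Nat.cast_add_one_ne_zero _
    have h2 : ((B a)! : ℂ) ≠ 0 := Nat.cast_ne_zero.2 (Nat.factorial_ne_zero _)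
    rw [Finsupp.add_apply, Finsupp.single_eq_same, Nat.factorial_succ, pow_succ]
    push_cast
    field_simp
  · refine Finsupp.support_add.trans (Finset.union_subset (Finset.subset_insert _ _) ?_)
    exact Finsupp.support_single_subset.trans (by simp)

/-- The generating function `exp (∑ₐ wₐ Xᵃ)` of the weighted colored partitions. -/
noncomputable def partitionSeries {q : ℕ} (w : (Fin q → ℕ) → ℂ) : MvPowerSeries (Fin q) ℂ :=
  fun n => ∑ A ∈ partitionFinset n, partitionWeight w A

theorem coeff_partitionSeries {q : ℕ} (w : (Fin q → ℕ) → ℂ) (n : Fin q →₀ ℕ) :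
    MvPowerSeries.coeff n (partitionSeries w) = ∑ A ∈ partitionFinset n, partitionWeight w A :=
  rfl

theorem constantCoeff_partitionSeries {q : ℕ} (w : (Fin q → ℕ) → ℂ) :
    MvPowerSeries.constantCoeff (partitionSeries w) = 1 := by
  rw [← MvPowerSeries.coeff_zero_eq_constantCoeff_apply, coeff_partitionSeries]
  have h : partitionFinset (⇑(0 : Fin q →₀ ℕ)) = {0} := by
    ext A
    rw [mem_partitionFinset, Finset.mem_singleton]
    refine ⟨fun hA => ?_, fun hA => by subst hA; simp [col_eq_sum]⟩
    by_contra hne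
    obtain ⟨a, ha⟩ := Finsupp.support_nonempty_iff.2 hne
    exact a.2 (le_antisymm (le_of_mem_support ⟨A, hA⟩ ha) fun j => Nat.zero_le _)
  rw [h, Finset.sum_singleton, partitionWeight, Finsupp.prod_zero_index]

/-- The nonzero vector `b + eⱼ`. -/
def succVec {q : ℕ} (b : Fin q → ℕ) (j : Fin q) : NonzeroVec q :=
  ⟨b + Pi.single j 1, fun h => by simpa using congrFun h j⟩

/-- The derivative of `exp (∑ₐ wₐ Xᵃ)`.  On coefficients, `n j = ∑ₐ A(a) a j` for a partition `A`
of `n`, so that the left side counts partitions with a marked part `a`; removing that part is a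
bijection onto the pairs of a vector and a partition counted by the right side. -/
theorem pderiv_partitionSeries {q : ℕ} (w : (Fin q → ℕ) → ℂ) (j : Fin q) :
    MvPowerSeries.pderiv ℂ j (partitionSeries w) =
      (show MvPowerSeries (Fin q) ℂ from fun b => ((b j : ℂ) + 1) * w (succVec b j).1) *
        partitionSeries w := by
  classical
  ext m
  -- The hypothesis `a j ≠ 0` makes subtraction of `eⱼ` from the marked part reversible.
  have hcol : ∀ A ∈ partitionFinset (⇑(m + Finsupp.single j 1 : Fin q →₀ ℕ)),
      ((m j : ℂ) + 1) = ∑ a ∈ A.support.filter (fun a => a.1 j ≠ 0), (A a : ℂ) * (a.1 j : ℂ) := by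
    intro A hA
    have h := congrFun (mem_partitionFinset.1 hA) j
    rw [col, Finset.sum_apply] at h
    have h' := congrArg (Nat.cast : ℕ → ℂ) h
    have hne : ∀ a ∈ A.support, (A a : ℂ) * (a.1 j : ℂ) ≠ 0 → a.1 j ≠ 0 := fun a _ hne hz =>
      hne (by rw [hz, Nat.cast_zero, mul_zero])
    rw [Finset.sum_filter_of_ne hne]
    simpa using h'.symm
  rw [MvPowerSeries.coeff_pderiv, MvPowerSeries.coeff_mul, coeff_partitionSeries, Finset.sum_mul]
  rw [Finset.sum_congr rfl fun A hA => by rw [hcol A hA, Finset.mul_sum]]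
  simp_rw [coeff_partitionSeries, Finset.mul_sum]
  rw [Finset.sum_sigma', Finset.sum_sigma']
  symm
  refine Finset.sum_bij'
    (fun x _ => ⟨x.2 + Finsupp.single (succVec x.1.1 j) 1, succVec x.1.1 j⟩)
    (fun y _ => ⟨(Finsupp.equivFunOnFinite.symm y.2.1 - Finsupp.single j 1,
      Finsupp.equivFunOnFinite.symm (col (y.1 - Finsupp.single y.2 1))),
      y.1 - Finsupp.single y.2 1⟩) ?_ ?_ ?_ ?_ ?_
  · rintro ⟨⟨b, c⟩, B⟩ hx
    simp only [Finset.mem_sigma, Finset.HasAntidiagonal.mem_antidiagonal, mem_partitionFinset] at hx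
    simp only [Finset.mem_sigma, mem_partitionFinset, Finset.mem_filter, Finsupp.mem_support_iff]
    refine ⟨?_, by simp, by simp [succVec]⟩
    rw [col_add, col_single, hx.2, ← hx.1]
    simp [succVec, Finsupp.single_eq_pi_single, add_comm, add_left_comm]
  · rintro ⟨A, a⟩ hy
    simp only [Finset.mem_sigma, mem_partitionFinset, Finset.mem_filter,
      Finsupp.mem_support_iff] at hy
    simp only [Finset.mem_sigma, Finset.HasAntidiagonal.mem_antidiagonal, mem_partitionFinset]
    refine ⟨?_, rfl⟩
    obtain ⟨B, rfl⟩ : ∃ B, A = B + Finsupp.single a 1 :=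
      ⟨A - Finsupp.single a 1, (tsub_add_cancel_of_le (by
        simpa [Nat.one_le_iff_ne_zero] using hy.2.1)).symm⟩
    have h := hy.1
    rw [col_add, col_single] at h
    rw [add_tsub_cancel_right]
    ext l
    have hl := congrFun h l
    have hj := hy.2.2
    simp only [Pi.add_apply, Finsupp.add_apply] at hl
    simp only [Finsupp.add_apply, Finsupp.tsub_apply, Finsupp.equivFunOnFinite_symm_apply_apply]
    by_cases hlj : l = j
    · subst hlj
      simp only [Finsupp.single_eq_same] at hl ⊢
      omega
    · rw [Finsupp.single_eq_of_ne hlj] at hl ⊢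
      omega
  · rintro ⟨⟨b, c⟩, B⟩ hx
    simp only [Finset.mem_sigma, Finset.HasAntidiagonal.mem_antidiagonal, mem_partitionFinset] at hx
    have hb : Finsupp.equivFunOnFinite.symm (succVec (⇑b) j).1 - Finsupp.single j 1 = b := by
      ext l
      simp [succVec, Finsupp.single_eq_pi_single]
    have hc : Finsupp.equivFunOnFinite.symm (col B) = c := by
      ext l
      simp [hx.2]
    simp [hb, hc]
  · rintro ⟨A, a⟩ hy
    simp only [Finset.mem_sigma, mem_partitionFinset, Finset.mem_filter,
      Finsupp.mem_support_iff] at hy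
    have ha : succVec
        (⇑(Finsupp.equivFunOnFinite.symm a.1 - Finsupp.single j 1 : Fin q →₀ ℕ)) j = a := by
      ext l
      have hj := hy.2.2
      simp only [succVec, Pi.add_apply, Finsupp.tsub_apply,
        Finsupp.equivFunOnFinite_symm_apply_apply, Finsupp.single_eq_pi_single]
      by_cases hlj : l = j
      · subst hlj
        simp only [Pi.single_eq_same]
        omega
      · simp [hlj]
    have hA : A - Finsupp.single a 1 + Finsupp.single a 1 = A :=
      tsub_add_cancel_of_le (by simpa [Nat.one_le_iff_ne_zero] using hy.2.1)
    simp only [ha, hA]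
  · rintro ⟨⟨b, c⟩, B⟩ hx
    have h := partitionWeight_add_single w B (succVec b j)
    have hb : (((succVec b j).1 j : ℕ) : ℂ) = (b j : ℂ) + 1 := by simp [succVec]
    have hB : (B + Finsupp.single (succVec b j) 1 : NonzeroVec q →₀ ℕ) (succVec b j) =
        B (succVec b j) + 1 := by simp
    change ((b j : ℂ) + 1) * w (succVec b j).1 * partitionWeight w B =
      partitionWeight w (B + Finsupp.single (succVec b j) 1) *
        (((B + Finsupp.single (succVec b j) 1 : NonzeroVec q →₀ ℕ) (succVec b j) : ℕ) *
          ((succVec b j).1 j : ℕ))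
    rw [hb, hB, mul_assoc, ← h]
    ring

/-! ### The cycle index polynomial -/

/-- The weight `(|a| choose a) ωₐ / |a|` of a part `a`. -/
noncomputable def omegaWeight {q k : ℕ} (s : Fin q → Fin k → ℂ) (α : Fin k → ℝ) (a : Fin q → ℕ) :
    ℂ :=
  (Nat.multinomial Finset.univ a : ℂ) / (∑ j, a j : ℕ) * omega s α a

theorem aeval_cycleIndex {q k : ℕ} (s : Fin q → Fin k → ℂ) (α : Fin k → ℝ) (n : Fin q →₀ ℕ) :
    MvPolynomial.aeval (Omega n s α) (cycleIndex n) =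
      MvPowerSeries.coeff n (partitionSeries (omegaWeight s α)) := by
  have hf : (vecFactorial n : ℂ) ≠ 0 := Nat.cast_ne_zero.2 (vecFactorial_pos _).ne'
  rw [coeff_partitionSeries, ← sum_coloredPartition, cycleIndex, map_mul, map_sum, Finset.mul_sum]
  refine Finset.sum_congr rfl fun A _ => ?_
  have hω : ∏ a : A.1.support, Omega n s α ⟨a.1.1, le_of_mem_support A a.2⟩ ^ A.1 a.1 =
      ∏ a ∈ A.1.support, omega s α a.1 ^ A.1 a :=
    Finset.prod_coe_sort A.1.support fun a => omega s α a.1 ^ A.1 a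
  rw [map_mul, map_prod]
  simp only [map_pow, MvPolynomial.aeval_X, MvPolynomial.aeval_C, eq_ratCast]
  rw [hω, multinomialCoeff, partitionWeight, Finsupp.prod]
  push_cast
  rw [one_div, mul_assoc, inv_mul_cancel_left₀ hf, ← Finset.prod_mul_distrib]
  refine Finset.prod_congr rfl fun a _ => ?_
  rw [omegaWeight, mul_pow, div_pow, div_mul_eq_div_div, div_mul_eq_mul_div]
  push_cast
  rfl

/-- The logarithmic derivative of `exp (∑ₐ (|a| choose a) ωₐ Xᵃ / |a|)`: the factor `|a|` cancels
against the Pascal-type identity for multinomial coefficients. -/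
theorem succ_mul_omegaWeight {q k : ℕ} (s : Fin q → Fin k → ℂ) (α : Fin k → ℝ) (j : Fin q) :
    (show MvPowerSeries (Fin q) ℂ from
        fun b => ((b j : ℂ) + 1) * omegaWeight s α (succVec b j).1) =
      ∑ i, MvPowerSeries.C (s j i * α i) * geomSeries fun j => s j i := by
  ext b
  change ((b j : ℂ) + 1) * omegaWeight s α (succVec b j).1 = _
  have hm := congrArg (Nat.cast : ℕ → ℂ) (succ_mul_multinomial_add_single b j)
  have hs : ∑ l, (⇑b + Pi.single j 1 : Fin q → ℕ) l = ∑ l, b l + 1 := by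
    simp [Finset.sum_add_distrib]
  have hne : ((∑ l, b l : ℕ) : ℂ) + 1 ≠ 0 := Nat.cast_add_one_ne_zero _
  have hω : omega s α (succVec b j).1 = ∑ i, s j i * α i * ∏ l, s l i ^ b l := by
    rw [omega, dotProduct]
    refine Finset.sum_congr rfl fun i _ => ?_
    have h := prod_pow_add_single (fun l => s l i) b j
    rw [Finsupp.coe_add, Finsupp.single_eq_pi_single] at h
    simp only [succVec, Finset.prod_apply, Pi.pow_apply, h]
    ring
  rw [omegaWeight, hω, map_sum]
  simp_rw [MvPowerSeries.coeff_C_mul, coeff_geomSeries, Finset.mul_sum]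
  refine Finset.sum_congr rfl fun i _ => ?_
  simp only [succVec, hs]
  push_cast at hm hne ⊢
  field_simp
  linear_combination (s j i * α i * ∏ l, s l i ^ b l) * hm

/-- Both generating functions solve the same linear differential system with constant term `1`. -/
theorem momentSeries_eq_partitionSeries {q d : ℕ} (s : Fin q → Fin (d + 1) → ℂ)
    {α : Fin (d + 1) → ℝ} (hα : ∀ i, 0 < α i) :
    momentSeries s α = partitionSeries (omegaWeight s α) := by
  refine sub_eq_zero.1 (eq_zero_of_pderiv_mem_span
    (fun _ : Unit => momentSeries s α - partitionSeries (omegaWeight s α)) (fun _ => ?_)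
    (fun _ j => ?_) ())
  · simp [constantCoeff_momentSeries s hα, constantCoeff_partitionSeries]
  · rw [map_sub, pderiv_momentSeries_eq_mul s hα, pderiv_partitionSeries, succ_mul_omegaWeight,
      ← mul_sub]
    exact Ideal.mul_mem_left _ _ (Ideal.subset_span ⟨(), rfl⟩)

end DirichletMoments

theorem theoremt (d q : ℕ) (n : Fin q → ℕ) (α : Fin (d + 1) → ℝ) (hα : ∀ i, 0 < α i)
    (s : Fin q → Fin (d + 1) → ℂ) :
    IntegrableOn (fun x : Fin (d + 1) → ℝ => ∏ j, (s j ⬝ᵥ fun i => (x i : ℂ)) ^ n j)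
        (stdSimplex ℝ (Fin (d + 1))) (DirichletMoments.dirichlet α) ∧
      (∫ x in stdSimplex ℝ (Fin (d + 1)), ∏ j, (s j ⬝ᵥ fun i => (x i : ℂ)) ^ n j
          ∂(DirichletMoments.dirichlet α)) =
        (DirichletMoments.vecFactorial n : ℂ) /
            (DirichletMoments.pochhammerSymbol (∑ i, α i) (∑ j, n j) : ℂ) *
          MvPolynomial.aeval (DirichletMoments.Omega n s α) (DirichletMoments.cycleIndex n) := by
  open DirichletMoments in
  refine ⟨integrableOn_dirichlet hα (by unfold dotProduct; fun_prop), ?_⟩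
  obtain ⟨m, rfl⟩ : ∃ m : Fin q →₀ ℕ, n = m := ⟨Finsupp.equivFunOnFinite.symm n, by simp⟩
  have hs : 0 < ∑ l, α l := Finset.sum_pos (fun i _ => hα i) Finset.univ_nonempty
  have hp : (pochhammerSymbol (∑ i, α i) (∑ j, m j) : ℂ) ≠ 0 :=
    Complex.ofReal_ne_zero.2 (pochhammerSymbol_pos hs _).ne'
  have hf : (vecFactorial m : ℂ) ≠ 0 := Nat.cast_ne_zero.2 (vecFactorial_pos _).ne'
  rw [aeval_cycleIndex, ← momentSeries_eq_partitionSeries s hα, coeff_momentSeries, dirichletMean]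
  field_simp
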